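/- Let $n\ge 1$ and let $I=(M,W,P)$ be a stable marriage instance with $n$ men, $n$ women and complete strict preference lists; $P_a(b)\in\{1,\dots,n\}$ denotes the rank of $b$ in the list of $a$. For an agent $a$ let $\operatorname{minrank}(a)$ and $\operatorname{maxrank}(a)$ be the minimum and maximum of $P_b(a)$ over all agents $b$ of the opposite sex, and let $\operatorname{range}(I)=\max_{a}(\operatorname{maxrank}(a)-\operatorname{minrank}(a))+1$. A rotation exposed in a stable matching $\mu$ is a nonempty circular list of distinct pairs $\rho=(m_1,w_1),\dots,(m_\ell,w_\ell)$ of $\mu$ such that for every $i$ (cyclically) $w_{i+1}$ is the first woman after $w_i$ on the list of $m_i$ who prefers $m_i$ to her partner in $\mu$; its elimination is the matching $\mu\setminus\rho$ in which each $(m_i,w_i)$ is replaced by $(m_i,w_{i+1})$. Let $R(I)$ be the set of all rotations exposed in some stable matching of $I$, and for a stable matching $\mu$ let $R_\mu$ be the set of rotations eliminated in passing from the man-optimal stable matching to $\mu$. The rotation poset $\mathcal R(I)=(R(I),\prec)$ is given by: $\rho\prec\sigma$ iff $\rho\in R_\mu$ for every stable matching $\mu$ in which $\sigma$ is exposed.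 The rotation digraph $G(I)$ has vertex set $R(I)$ and an edge from $\rho'$ to $\rho$ iff (1) for some pair $(m,w)$ in $\rho$, $\rho'$ moves $m$ to $w$ (that is, $m=m_i$ and $w=w_{i+1}$ for consecutive pairs of $\rho'$); or (2) $\rho'\ne\rho$ and for some pair $(m,w)$ not in $\rho$, $\rho'$ moves $w$ above $m$ and $\rho$ moves $m$ below $w$ (that is, in $\rho'$ the woman $w$ passes from some $m_{i+1}$ to $m_i$ with $m$ strictly between them in her list, and in $\rho$ the man $m$ passes from some $w_i$ to $w_{i+1}$ with $w$ strictly between them in his list). A path decomposition of a graph $(V,E)$ is a finite sequence $X_1,\dots,X_r$ of subsets of $V$ with union $V$ such that each edge has both ends in some $X_i$, and $X_i\cap X_k\subseteq X_j$ whenever $i\le j\le k$. Its width is $\max_i|X_i|-1$ (taken to be $0$ if all $X_i$ are empty), and the pathwidth of the graph is the minimum width of a path decomposition. The pathwidth of a directed graph is that of its underlying undirected graph. Theorem. If $\operatorname{range}(I)\le k$, then the Hasse diagram of the rotation poset $\mathcal R(I)$ has pathwidth at most $50k^2$, and the rotation digraph $G(I)$ has pathwidth at most $50k^2$. -/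

import Mathlib

/-- A stable matching instance of size `n` with complete preference lists: `n` men, `n` women, and
for every agent a strict ranking (total order) of all agents of the opposite sex.  Ranks are
`0`-based here; `rankM` and `rankW` below are the usual `1`-based ranks. -/
structure SMInstance (n : ℕ) (M W : Type*) where
  card_men : Nat.card M = n
  card_women : Nat.card W = n
  menList : M → (W ≃ Fin n)
  womenList : W → (M ≃ Fin n)

namespace SMInstance

variable {n : ℕ} {M W : Type*}

/-- The rank `P_m(w) ∈ {1, …, n}` of the woman `w` in the list of the man `m`. -/
def rankM (I : SMInstance n M W) (m : M) (w : W) : ℕ := (I.menList m w : ℕ) + 1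

/-- The rank `P_w(m) ∈ {1, …, n}` of the man `m` in the list of the woman `w`. -/
def rankW (I : SMInstance n M W) (w : W) (m : M) : ℕ := (I.womenList w m : ℕ) + 1

/-! ### Range of an instance -/

noncomputable def minrankWoman (I : SMInstance n M W) (w : W) : ℕ := ⨅ m : M, I.rankM m w

noncomputable def maxrankWoman (I : SMInstance n M W) (w : W) : ℕ := ⨆ m : M, I.rankM m w

noncomputable def minrankMan (I : SMInstance n M W) (m : M) : ℕ := ⨅ w : W, I.rankW w m

noncomputable def maxrankMan (I : SMInstance n M W) (m : M) : ℕ := ⨆ w : W, I.rankW w m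

/-- The range of `I`: the maximum over all agents of `maxrank - minrank`, plus one. -/
noncomputable def range (I : SMInstance n M W) : ℕ :=
  max (⨆ m : M, (I.maxrankMan m - I.minrankMan m))
      (⨆ w : W, (I.maxrankWoman w - I.minrankWoman w)) + 1

/-! ### Stable matchings -/

/-- A (perfect) matching, given as a bijection `μ : M ≃ W`, is stable if it has no blocking pair. -/
def IsStable (I : SMInstance n M W) (μ : M ≃ W) : Prop :=
  ∀ (m : M) (w : W), ¬ (I.rankM m w < I.rankM m (μ m) ∧ I.rankW w m < I.rankW w (μ.symm w))

/-- The man-optimal stable matching: every man gets his best stable partner. -/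
def IsManOptimal (I : SMInstance n M W) (μ : M ≃ W) : Prop :=
  I.IsStable μ ∧ ∀ ν : M ≃ W, I.IsStable ν → ∀ m : M, I.rankM m (μ m) ≤ I.rankM m (ν m)

/-! ### Rotations

A rotation is a circular list of man-woman pairs, i.e. a `Cycle (M × W)`. -/

open Classical in
/-- `q` comes directly after `p` on the circular list `ρ` of distinct elements (cyclically).
On `ρ = (m₁, w₁), …, (m_ℓ, w_ℓ)` these are `p = (m_i, w_i)` and `q = (m_{i+1}, w_{i+1})`. -/
def Follows {α : Type*} (ρ : Cycle α) (p q : α) : Prop :=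
  ∃ (h : ρ.Nodup) (hp : p ∈ ρ), ρ.next h p hp = q

/-- `w` is the first woman on `m`'s list after `m`'s partner in `μ` who prefers `m` to her own
partner in `μ`. -/
def IsFirstAfter (I : SMInstance n M W) (μ : M ≃ W) (m : M) (w : W) : Prop :=
  I.rankM m (μ m) < I.rankM m w ∧
  I.rankW w m < I.rankW w (μ.symm w) ∧
  ∀ w' : W, I.rankM m (μ m) < I.rankM m w' → I.rankM m w' < I.rankM m w →
    ¬ I.rankW w' m < I.rankW w' (μ.symm w')

/-- The (nonempty) circular list `ρ` of distinct pairs is a rotation exposed in the stable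
matching `μ`. -/
structure IsExposed (I : SMInstance n M W) (μ : M ≃ W) (ρ : Cycle (M × W)) : Prop where
  stable : I.IsStable μ
  ne_nil : ρ ≠ Cycle.nil
  nodup : ρ.Nodup
  mem_matching : ∀ p ∈ ρ, μ p.1 = p.2
  first_after : ∀ p q : M × W, Follows ρ p q → I.IsFirstAfter μ p.1 q.2

/-- `μ'` is the elimination `μ \ ρ`: as sets of pairs, `μ'` is obtained from `μ` by deleting the
pairs `(m_i, w_i)` of `ρ` and adding the pairs `(m_i, w_{i+1})`. -/
def IsElimination (μ : M ≃ W) (ρ : Cycle (M × W)) (μ' : M ≃ W) : Prop :=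
  {x : M × W | μ' x.1 = x.2} =
    ({x : M × W | μ x.1 = x.2} \ {x | x ∈ ρ}) ∪
      {x | ∃ p q : M × W, Follows ρ p q ∧ x = (p.1, q.2)}

/-- `I.Eliminates μ S`: the stable matching `μ` is obtained from the man-optimal stable matching by
successively eliminating a sequence of exposed rotations, and `S` is the set of the rotations in
this sequence. -/
inductive Eliminates (I : SMInstance n M W) : (M ≃ W) → Set (Cycle (M × W)) → Prop
  | start (μ : M ≃ W) (h : I.IsManOptimal μ) : Eliminates I μ ∅
  | step (μ μ' : M ≃ W) (S : Set (Cycle (M × W))) (ρ : Cycle (M × W))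
      (h : Eliminates I μ S) (hρ : I.IsExposed μ ρ) (he : IsElimination μ ρ μ')
      (hμ' : I.IsStable μ') : Eliminates I μ' (insert ρ S)

/-- `R_μ`: the rotations that are eliminated on the way from the man-optimal stable matching
to `μ`. -/
def eliminatedSet (I : SMInstance n M W) (μ : M ≃ W) : Set (Cycle (M × W)) :=
  {ρ | ∃ S, I.Eliminates μ S ∧ ρ ∈ S}

/-- `R(I)`: the rotations of `I`, i.e. those exposed in some stable matching. -/
def Rotation (I : SMInstance n M W) : Type _ :=
  {ρ : Cycle (M × W) // ∃ μ : M ≃ W, I.IsExposed μ ρ}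

/-- `ρ ≺ σ`: the rotation `ρ` has been eliminated in every stable matching in which `σ` is
exposed. -/
def Precedes (I : SMInstance n M W) (ρ σ : I.Rotation) : Prop :=
  ∀ μ : M ≃ W, I.IsExposed μ σ.1 → ρ.1 ∈ I.eliminatedSet μ

/-! Precedence is a strict partial order. -/

theorem IsElimination.le {I : SMInstance n M W} {μ μ' : M ≃ W} {ρ : Cycle (M × W)}
    (he : IsElimination μ ρ μ') (hρ : I.IsExposed μ ρ) (m : M) :
    I.rankM m (μ m) ≤ I.rankM m (μ' m) := by
  have h : (m, μ' m) ∈ {x : M × W | μ' x.1 = x.2} := rfl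
  rw [he] at h
  rcases h with ⟨h, -⟩ | ⟨p, q, hpq, hx⟩
  · rw [show μ m = μ' m from h]
  · obtain ⟨h1, h2⟩ := Prod.mk.inj hx
    have := (hρ.first_after p q hpq).1
    rw [← h1, ← h2] at this
    exact this.le

theorem IsElimination.lt {I : SMInstance n M W} {μ μ' : M ≃ W} {ρ : Cycle (M × W)}
    (he : IsElimination μ ρ μ') (hρ : I.IsExposed μ ρ) {x : M × W} (hx : x ∈ ρ) :
    I.rankM x.1 x.2 < I.rankM x.1 (μ' x.1) := by
  have h : (x.1, μ' x.1) ∈ {x : M × W | μ' x.1 = x.2} := rfl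
  have hm := hρ.mem_matching x hx
  rw [he] at h
  rcases h with ⟨h, h'⟩ | ⟨p, q, hpq, hx'⟩
  · have h2 : μ x.1 = μ' x.1 := h
    refine absurd ?_ h'
    change (x.1, μ' x.1) ∈ ρ
    rw [← h2, hm]
    exact hx
  · obtain ⟨h1, h2⟩ := Prod.mk.inj hx'
    have := (hρ.first_after p q hpq).1
    rw [← h1, ← h2, hm] at this
    exact this

theorem Eliminates.lt {I : SMInstance n M W} {μ : M ≃ W} {S : Set (Cycle (M × W))}
    (h : I.Eliminates μ S) {ρ : Cycle (M × W)} (hρ : ρ ∈ S) {x : M × W} (hx : x ∈ ρ) :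
    I.rankM x.1 x.2 < I.rankM x.1 (μ x.1) := by
  induction h with
  | start μ h => exact absurd hρ (Set.notMem_empty _)
  | step μ μ' S σ h hσ he hμ' ih =>
    rcases Set.mem_insert_iff.1 hρ with rfl | hS
    · exact he.lt hσ hx
    · exact (ih hS).trans_le (he.le hσ _)

theorem Eliminates.factor {I : SMInstance n M W} {μ : M ≃ W} {S : Set (Cycle (M × W))}
    (h : I.Eliminates μ S) {σ : Cycle (M × W)} (hσ : σ ∈ S) :
    ∃ ν : M ≃ W, I.IsExposed ν σ ∧
      ∀ T, I.Eliminates ν T → ∃ T', T ⊆ T' ∧ I.Eliminates μ T' := by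
  induction h with
  | start μ h => exact absurd hσ (Set.notMem_empty _)
  | step μ μ' S τ h hτ he hμ' ih =>
    rcases Set.mem_insert_iff.1 hσ with rfl | hS
    · exact ⟨μ, hτ, fun T hT => ⟨_, Set.subset_insert _ _, .step μ μ' T σ hT hτ he hμ'⟩⟩
    · obtain ⟨ν, hν, H⟩ := ih hS
      refine ⟨ν, hν, fun T hT => ?_⟩
      obtain ⟨T', hTT', hT'⟩ := H T hT
      exact ⟨_, hTT'.trans (Set.subset_insert _ _), .step μ μ' T' τ hT' hτ he hμ'⟩

instance (I : SMInstance n M W) : IsStrictOrder I.Rotation I.Precedes where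
  irrefl ρ h := by
    obtain ⟨μ, hμ⟩ := ρ.2
    obtain ⟨S, hS, hρ⟩ := h μ hμ
    have key : ∀ c : Cycle (M × W), c ≠ Cycle.nil → ∃ x, x ∈ c := fun c =>
      Cycle.induction_on c (fun h => absurd rfl h) (fun a l _ _ => ⟨a, by simp⟩)
    obtain ⟨x, hx⟩ := key ρ.1 hμ.ne_nil
    have := hS.lt hρ hx
    rw [hμ.mem_matching x hx] at this
    exact lt_irrefl _ this
  trans ρ σ τ h₁ h₂ μ hμ := by
    obtain ⟨S, hS, hσ⟩ := h₂ μ hμ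
    obtain ⟨ν, hν, H⟩ := hS.factor hσ
    obtain ⟨T, hT, hρ⟩ := h₁ ν hν
    obtain ⟨T', hTT', hT'⟩ := H T hT
    exact ⟨T', hT', hTT' hρ⟩

/-- The rotation poset `(R(I), ≺)`; the strict order `ρ < σ` is `I.Precedes ρ σ` by definition. -/
noncomputable instance (I : SMInstance n M W) : PartialOrder I.Rotation :=
  partialOrderOfSO I.Precedes

/-! ### The rotation digraph -/

/-- `ρ` moves the man `m` (down) to `w`. -/
def MovesTo (ρ : Cycle (M × W)) (m : M) (w : W) : Prop :=
  ∃ p q : M × W, Follows ρ p q ∧ p.1 = m ∧ q.2 = w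

/-- `ρ` moves the man `m = m_i` below `w`: `w` is strictly between `w_i` and `w_{i+1}` in `m`'s
list. -/
def MovesManBelow (I : SMInstance n M W) (ρ : Cycle (M × W)) (m : M) (w : W) : Prop :=
  ∃ p q : M × W, Follows ρ p q ∧ p.1 = m ∧
    I.rankM m p.2 < I.rankM m w ∧ I.rankM m w < I.rankM m q.2

/-- `ρ` moves the woman `w = w_{i+1}` above `m`: `m` is strictly between `m_i` and `m_{i+1}` in
`w`'s list. -/
def MovesWomanAbove (I : SMInstance n M W) (ρ : Cycle (M × W)) (w : W) (m : M) : Prop :=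
  ∃ p q : M × W, Follows ρ p q ∧ q.2 = w ∧
    I.rankW w p.1 < I.rankW w m ∧ I.rankW w m < I.rankW w q.1

/-- The rotation digraph `G(I)`: there is an edge from `ρ'` to `ρ` if one of two rules applies.
Rule 1: some pair `(m, w)` is in `ρ`, and `ρ'` moves `m` to `w`.
Rule 2: for some pair `(m, w)` not in `ρ`, `ρ'` moves `w` above `m`, `ρ` moves `m` below `w`,
and `ρ' ≠ ρ`. -/
def rotationDigraph (I : SMInstance n M W) : Digraph I.Rotation where
  Adj ρ' ρ :=
    (∃ (m : M) (w : W), (m, w) ∈ ρ.1 ∧ MovesTo ρ'.1 m w) ∨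
    (∃ (m : M) (w : W), (m, w) ∉ ρ.1 ∧ I.MovesWomanAbove ρ'.1 w m ∧
      I.MovesManBelow ρ.1 m w ∧ ρ' ≠ ρ)

end SMInstance

/-! ### Pathwidth -/

/-- A path decomposition of the graph `G`: a finite sequence of sets of vertices ("bags"). -/
structure PathDecomposition {V : Type*} (G : SimpleGraph V) where
  length : ℕ
  bag : Fin length → Set V
  cover : (⋃ i, bag i) = Set.univ
  edge : ∀ u v : V, G.Adj u v → ∃ i, u ∈ bag i ∧ v ∈ bag i
  interval : ∀ i j k : Fin length, i ≤ j → j ≤ k → bag i ∩ bag k ⊆ bag j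

/-- The width: the maximal cardinality of a bag, minus one (and `0` if all bags are empty). -/
noncomputable def PathDecomposition.width {V : Type*} {G : SimpleGraph V}
    (X : PathDecomposition G) : ℕ∞ :=
  (⨆ i, (X.bag i).encard) - 1

/-- The pathwidth of `G`: the minimum width of a path decomposition of `G`. -/
noncomputable def pathwidth {V : Type*} (G : SimpleGraph V) : ℕ∞ :=
  ⨅ X : PathDecomposition G, X.width

/-! ### Circular lists -/

namespace SMInstance

section Follows

variable {α : Type*} {ρ ρ' : Cycle α} {p q r : α}

/-! Index bags by ranks `t = 0, …, n`, and let a rotation occupy every `t` between the least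
`minrankMan` and the greatest `maxrankMan` among its men. Each rotation then occupies an interval,
and two things remain: adjacent rotations meet in a bag, and bags are small.

Adjacency. If two rotations share a man, any rank he receives is a common index. If `ρ` moves `w`
above `m` and `σ` moves `m` below `w`, take the rank of `m` for `w`: the old and new partners of
`w`, both men of `ρ`, lie on either side of it. Every edge of the digraph is of one of these kinds.
For a covering pair the same holds because some elimination of `ρ` newly exposes `σ`
(`exists_isElimination_of_covBy`): without a common man, a woman skipped by `σ` must have been
willing before that elimination and unwilling after it, so `ρ` moved her.

Size. In a stable matching a man's rank of his partner exceeds his `minrankMan` by at most `2k`, and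
symmetrically for women (`IsStable.rankM_le_minrankMan`). Consequently a rotation in bag `t`
contains a pair whose woman has `minrankWoman` within `O(k)` of `t` and ranks her man within `2k` of
that value. There are `O(k)` such women, with `O(k)` men each, and a pair determines its rotation
(`IsExposed.eq_of_mem`).

The structural input is lattice theory: opposition of interests, meets, and a description of
precedence by `Passed`, which compares partners instead of elimination histories. -/

theorem Follows.mem_left (h : Follows ρ p q) : p ∈ ρ := h.2.1

theorem Follows.mem_right (h : Follows ρ p q) : q ∈ ρ := by
  classical
  obtain ⟨hn, hp, rfl⟩ := h
  exact Cycle.next_mem _ _ _ _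

theorem exists_follows (hn : ρ.Nodup) (hp : p ∈ ρ) : ∃ q, Follows ρ p q := ⟨_, hn, hp, rfl⟩

theorem follows_iff_formPerm [DecidableEq α] (hn : ρ.Nodup) :
    Follows ρ p q ↔ p ∈ ρ ∧ ρ.formPerm hn p = q := by
  constructor
  · rintro ⟨hn, hp, rfl⟩
    refine ⟨hp, ?_⟩
    rw [Cycle.formPerm_apply_mem_eq_next _ _ _ hp]
    congr!
  · rintro ⟨hp, rfl⟩
    refine ⟨hn, hp, ?_⟩
    rw [Cycle.formPerm_apply_mem_eq_next _ _ _ hp]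
    congr!

/-- A property that passes from every element of a circular list to the next one holds for all
elements as soon as it holds for one. -/
theorem forall_of_follows {P : α → Prop} (hn : ρ.Nodup)
    (hstep : ∀ p q, Follows ρ p q → P p → P q) (hp : p ∈ ρ) (h : P p) : ∀ q ∈ ρ, P q := by
  classical
  intro q hq
  have hiter : ∀ i : ℕ, ((ρ.formPerm hn) ^ i) p ∈ ρ ∧ P (((ρ.formPerm hn) ^ i) p) := by
    intro i
    induction i with
    | zero => exact ⟨hp, h⟩
    | succ i ih =>
      rw [pow_succ', Equiv.Perm.mul_apply]
      have hf : Follows ρ _ _ := (follows_iff_formPerm hn).2 ⟨ih.1, rfl⟩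
      exact ⟨hf.mem_right, hstep _ _ hf ih.2⟩
  induction ρ using Quotient.inductionOn' with
  | h l =>
    have hl : l.Nodup := hn
    have hc := hl.isCycleOn_formPerm
    have hfin : ({a | a ∈ l} : Set α).Finite := l.finite_toSet
    obtain ⟨i, hi⟩ := Equiv.Perm.IsCycleOn.exists_pow_eq' (f := l.formPerm) hfin hc
      (show p ∈ {a | a ∈ l} from hp) (show q ∈ {a | a ∈ l} from hq)
    rw [← hi]
    exact (hiter i).2

/-- The two successor permutations agree. A permutation determines its circular list except in
length at most one, where the common element `p` decides. -/
theorem cycle_eq_of_follows (hn : ρ.Nodup) (hn' : ρ'.Nodup) (hp : p ∈ ρ) (hp' : p ∈ ρ')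
    (hstep : ∀ p q q', Follows ρ p q → Follows ρ' p q' → q = q') : ρ = ρ' := by
  classical
  have key : ∀ {ρ ρ' : Cycle α}, ρ.Nodup → ρ'.Nodup → p ∈ ρ → p ∈ ρ' →
      (∀ p q q', Follows ρ p q → Follows ρ' p q' → q = q') → ∀ x ∈ ρ, x ∈ ρ' := by
    intro ρ ρ' hn hn' hp hp' hstep
    refine forall_of_follows hn ?_ hp hp'
    intro x y hxy hx
    obtain ⟨z, hz⟩ := exists_follows hn' hx
    rw [hstep _ _ _ hxy hz]
    exact hz.mem_right
  have h1 := key hn hn' hp hp' hstep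
  have h2 := key hn' hn hp' hp fun x y z h h' => (hstep x z y h' h).symm
  have hperm : ρ.formPerm hn = ρ'.formPerm hn' := by
    ext x
    by_cases hx : x ∈ ρ
    · exact hstep x _ _ ((follows_iff_formPerm hn).2 ⟨hx, rfl⟩)
        ((follows_iff_formPerm hn').2 ⟨h1 x hx, rfl⟩)
    · rw [Cycle.formPerm_eq_self_of_notMem _ _ _ hx,
        Cycle.formPerm_eq_self_of_notMem _ _ _ fun h => hx (h2 x h)]
  rcases Cycle.formPerm_eq_formPerm_iff.1 hperm with h | ⟨hs, hs'⟩
  · exact h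
  · have single : ∀ {c : Cycle α}, c.Subsingleton → p ∈ c → c = ([p] : List α) := by
      intro c
      induction c using Quotient.inductionOn' with
      | h l =>
        intro hc hpc
        have hl : l.length ≤ 1 := hc
        have hpl : p ∈ l := hpc
        match l, hl, hpl with
        | [a], _, hpl =>
          rw [List.mem_singleton] at hpl
          subst hpl
          rfl
    rw [single hs hp, single hs' hp']

theorem exists_mem_of_ne_nil (h : ρ ≠ Cycle.nil) : ∃ x, x ∈ ρ := by
  induction ρ using Cycle.induction_on with
  | nil => exact absurd rfl h
  | cons a l _ => exact ⟨a, by simp⟩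

theorem Follows.eq_apply_of_periodicOrbit {f : α → α} {x : α}
    (h : Follows (Function.periodicOrbit f x) p q) : q = f p := by
  classical
  have hn := h.1
  obtain ⟨hp, h⟩ := (follows_iff_formPerm hn).1 h
  rw [Function.periodicOrbit, Cycle.mem_coe_iff] at hp
  obtain ⟨i, hi, rfl⟩ := List.getElem_of_mem hp
  have hl : (((List.range (Function.minimalPeriod f x)).map fun n => f^[n] x)).Nodup := hn
  have h' : (((List.range (Function.minimalPeriod f x)).map fun n => f^[n] x)).formPerm
    (((List.range (Function.minimalPeriod f x)).map fun n => f^[n] x)[i]) = q := h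
  rw [List.formPerm_apply_getElem _ hl i hi] at h'
  rw [← h']
  simp only [List.getElem_map, List.getElem_range, List.length_map, List.length_range]
  rw [Function.iterate_mod_minimalPeriod_eq, Function.iterate_succ_apply']

end Follows

theorem exists_iterate_mem_periodicPts {α : Type*} [Finite α] (f : α → α) (x : α) :
    ∃ i, f^[i] x ∈ Function.periodicPts f := by
  obtain ⟨i, j, hij, h⟩ := Finite.exists_ne_map_eq_of_infinite fun n : ℕ => f^[n] x
  wlog hlt : i < j generalizing i j
  · exact this j i hij.symm h.symm (by omega)
  refine ⟨i, j - i, by omega, ?_⟩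
  change f^[j - i] (f^[i] x) = f^[i] x
  rw [← Function.iterate_add_apply, show j - i + i = j by omega]
  exact h.symm

end SMInstance

/-! ### The lattice of stable matchings -/

namespace SMInstance

section Lattice

variable {n : ℕ} {M W : Type*} {I : SMInstance n M W} {μ ν κ : M ≃ W}

theorem rankM_injective (I : SMInstance n M W) (m : M) : Function.Injective (I.rankM m) := by
  intro w w' h
  exact (I.menList m).injective (Fin.ext (Nat.succ_injective h))

theorem rankW_injective (I : SMInstance n M W) (w : W) : Function.Injective (I.rankW w) := by
  intro m m' h
  exact (I.womenList w).injective (Fin.ext (Nat.succ_injective h))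

theorem finite_men (I : SMInstance n M W) (hn : 0 < n) : Finite M :=
  Nat.finite_of_card_ne_zero (by rw [I.card_men]; omega)

/-- A man who strictly prefers his partner in `μ` to his partner in `ν` leaves his partner in `μ`
worse off there than in `ν`. -/
theorem IsStable.woman_lt_of_man_lt (hν : I.IsStable ν) {m : M}
    (h : I.rankM m (μ m) < I.rankM m (ν m)) :
    I.rankW (μ m) (ν.symm (μ m)) < I.rankW (μ m) m := by
  refine lt_of_le_of_ne (not_lt.1 fun h' => hν m (μ m) ⟨h, h'⟩) fun h' => ?_
  have h1 := I.rankW_injective _ h'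
  rw [Equiv.symm_apply_eq] at h1
  rw [h1] at h
  exact lt_irrefl _ h

theorem IsStable.man_lt_of_woman_lt (hμ : I.IsStable μ) {w : W}
    (h : I.rankW w (ν.symm w) < I.rankW w (μ.symm w)) :
    I.rankM (ν.symm w) (μ (ν.symm w)) < I.rankM (ν.symm w) w := by
  refine lt_of_le_of_ne (not_lt.1 fun h' => hμ (ν.symm w) w ⟨h', h⟩) fun h' => ?_
  have h1 := I.rankM_injective _ h'
  rw [← Equiv.eq_symm_apply] at h1
  rw [h1] at h
  exact lt_irrefl _ h

/-- Opposition of interests: if a man prefers `μ` to `ν`, then his partner in `ν` prefers `ν`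
to `μ`. -/
theorem IsStable.woman_lt_of_man_lt' [Finite M] (hμ : I.IsStable μ) (hν : I.IsStable ν) {m : M}
    (h : I.rankM m (μ m) < I.rankM m (ν m)) :
    I.rankW (ν m) m < I.rankW (ν m) (μ.symm (ν m)) := by
  have : Finite W := Finite.of_equiv M μ
  let A : Set M := {m | I.rankM m (μ m) < I.rankM m (ν m)}
  let B : Set W := {w | I.rankW w (ν.symm w) < I.rankW w (μ.symm w)}
  have hAB : μ '' A ⊆ B := by
    rintro _ ⟨m, hm, rfl⟩
    change I.rankW (μ m) (ν.symm (μ m)) < I.rankW (μ m) (μ.symm (μ m))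
    rw [Equiv.symm_apply_apply]
    exact hν.woman_lt_of_man_lt hm
  have hBA : ν.symm '' B ⊆ A := by
    rintro _ ⟨w, hw, rfl⟩
    change I.rankM (ν.symm w) (μ (ν.symm w)) < I.rankM (ν.symm w) (ν (ν.symm w))
    rw [Equiv.apply_symm_apply]
    exact hμ.man_lt_of_woman_lt hw
  -- `μ` embeds `A` in `B` and `ν.symm` embeds `B` in `A`; by finiteness the second map is onto, so
  -- every man of `A` has his `ν`-partner in `B`.
  have hcard : A.ncard ≤ (ν.symm '' B).ncard := by
    rw [Set.ncard_image_of_injective _ ν.symm.injective,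
      ← Set.ncard_image_of_injective A μ.injective]
    exact Set.ncard_le_ncard hAB
  have heq := Set.eq_of_subset_of_ncard_le hBA hcard
  have hm : m ∈ ν.symm '' B := heq ▸ h
  obtain ⟨w, hw, rfl⟩ := hm
  have hw' : I.rankW w (ν.symm w) < I.rankW w (μ.symm w) := hw
  rwa [Equiv.apply_symm_apply]

/-- If a woman prefers `ν` to `μ`, then her partner in `μ` prefers `μ` to `ν`. -/
theorem IsStable.man_lt_of_woman_lt' [Finite M] (hμ : I.IsStable μ) (hν : I.IsStable ν) {w : W}
    (h : I.rankW w (ν.symm w) < I.rankW w (μ.symm w)) :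
    I.rankM (μ.symm w) w < I.rankM (μ.symm w) (ν (μ.symm w)) := by
  have key : ¬ I.rankM (μ.symm w) (ν (μ.symm w)) < I.rankM (μ.symm w) (μ (μ.symm w)) := by
    intro h'
    have := hν.woman_lt_of_man_lt' hμ h'
    rw [Equiv.apply_symm_apply] at this
    exact absurd h this.not_gt
  rw [Equiv.apply_symm_apply, not_lt] at key
  refine lt_of_le_of_ne key fun h' => ?_
  have h1 := I.rankM_injective _ h'
  have h2 : ν.symm w = μ.symm w := by rw [Equiv.symm_apply_eq]; exact h1
  rw [h2] at h
  exact lt_irrefl _ h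

/-- If all men weakly prefer `μ` to `ν`, then all women weakly prefer `ν` to `μ`. -/
theorem IsStable.woman_le (hν : I.IsStable ν) (h : ∀ m, I.rankM m (μ m) ≤ I.rankM m (ν m))
    (w : W) : I.rankW w (ν.symm w) ≤ I.rankW w (μ.symm w) := by
  by_contra! hw
  have := hν.man_lt_of_woman_lt hw
  have h1 := h (μ.symm w)
  rw [Equiv.apply_symm_apply] at h1
  omega

/-- The sum of the men's ranks serves as a strictly monotone weight, for choosing extremal
matchings. -/
theorem matching_eq_of_sum_le [Fintype M] (h : ∀ m, I.rankM m (μ m) ≤ I.rankM m (ν m))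
    (hs : ∑ m, I.rankM m (ν m) ≤ ∑ m, I.rankM m (μ m)) : μ = ν := by
  have := (Finset.sum_eq_sum_iff_of_le fun m _ => h m).1
    (le_antisymm (Finset.sum_le_sum fun m _ => h m) hs)
  ext m
  exact I.rankM_injective m (this m (Finset.mem_univ m))

open Classical in
/-- The function sending every man to the better of his partners in `μ` and `ν`. -/
noncomputable def betterPartner (I : SMInstance n M W) (μ ν : M ≃ W) (m : M) : W :=
  if I.rankM m (μ m) ≤ I.rankM m (ν m) then μ m else ν m

theorem betterPartner_spec (I : SMInstance n M W) (μ ν : M ≃ W) (m : M) :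
    (I.betterPartner μ ν m = μ m ∧ I.rankM m (μ m) ≤ I.rankM m (ν m)) ∨
    (I.betterPartner μ ν m = ν m ∧ I.rankM m (ν m) < I.rankM m (μ m)) := by
  unfold betterPartner
  split_ifs with h
  · exact .inl ⟨rfl, h⟩
  · exact .inr ⟨rfl, not_le.1 h⟩

/-- The meet of two stable matchings: every man gets the better of his two partners. -/
theorem IsStable.exists_meet [Finite M] (hμ : I.IsStable μ) (hν : I.IsStable ν) :
    ∃ κ : M ≃ W, I.IsStable κ ∧
      (∀ m, (κ m = μ m ∧ I.rankM m (μ m) ≤ I.rankM m (ν m)) ∨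
        (κ m = ν m ∧ I.rankM m (ν m) ≤ I.rankM m (μ m))) ∧
      (∀ w, κ.symm w = μ.symm w ∨ κ.symm w = ν.symm w) := by
  -- If two men claimed the same woman, one from `μ` and one from `ν`, she would strictly prefer
  -- each of them to the other.
  have hconf : ∀ m m' : M, m ≠ m' → μ m = ν m' → I.rankM m (μ m) ≤ I.rankM m (ν m) →
      I.rankM m' (ν m') ≤ I.rankM m' (μ m') → False := by
    intro m m' hne he h1 h2
    have h1' : I.rankM m (μ m) < I.rankM m (ν m) := by
      refine lt_of_le_of_ne h1 fun h => hne ?_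
      exact ν.injective ((I.rankM_injective m h).symm.trans he)
    have h2' : I.rankM m' (ν m') < I.rankM m' (μ m') := by
      refine lt_of_le_of_ne h2 fun h => hne ?_
      exact μ.injective (he.trans (I.rankM_injective m' h))
    have a := hν.woman_lt_of_man_lt h1'
    have b := hμ.woman_lt_of_man_lt h2'
    rw [he, Equiv.symm_apply_apply] at a
    rw [← he, Equiv.symm_apply_apply, he] at b
    omega
  have hinj : Function.Injective (I.betterPartner μ ν) := by
    intro m m' h
    by_contra hne
    rcases I.betterPartner_spec μ ν m with ⟨e, l⟩ | ⟨e, l⟩ <;>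
      rcases I.betterPartner_spec μ ν m' with ⟨e', l'⟩ | ⟨e', l'⟩ <;> rw [e, e'] at h
    · exact hne (μ.injective h)
    · exact hconf m m' hne h l l'.le
    · exact hconf m' m (Ne.symm hne) h.symm l' l.le
    · exact hne (ν.injective h)
  have hbij : Function.Bijective (I.betterPartner μ ν) :=
    ⟨hinj, (Finite.injective_iff_surjective_of_equiv μ).1 hinj⟩
  let κ : M ≃ W := Equiv.ofBijective _ hbij
  have hm : ∀ m, (κ m = μ m ∧ I.rankM m (μ m) ≤ I.rankM m (ν m)) ∨
      (κ m = ν m ∧ I.rankM m (ν m) ≤ I.rankM m (μ m)) := fun m =>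
    (I.betterPartner_spec μ ν m).imp id fun h => ⟨h.1, h.2.le⟩
  have hw : ∀ w, κ.symm w = μ.symm w ∨ κ.symm w = ν.symm w := by
    intro w
    rcases hm (κ.symm w) with ⟨h, -⟩ | ⟨h, -⟩ <;> rw [Equiv.apply_symm_apply] at h
    · exact .inl (by rw [Equiv.eq_symm_apply, ← h])
    · exact .inr (by rw [Equiv.eq_symm_apply, ← h])
  refine ⟨κ, ?_, hm, hw⟩
  rintro m w ⟨h1, h2⟩
  have h3 : I.rankM m w < I.rankM m (μ m) ∧ I.rankM m w < I.rankM m (ν m) := by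
    rcases hm m with ⟨h, h'⟩ | ⟨h, h'⟩ <;> rw [h] at h1 <;> omega
  rcases hw w with h | h <;> rw [h] at h2
  · exact hμ m w ⟨h3.1, h2⟩
  · exact hν m w ⟨h3.2, h2⟩

end Lattice

/-! ### Exposed rotations and their elimination -/

section Rotations

variable {n : ℕ} {M W : Type*} {I : SMInstance n M W} {μ ν κ ν' : M ≃ W}
  {ρ σ τ : Cycle (M × W)} {p q : M × W}

/-- If a man prefers the stable matching `ν` to the stable matching `μ`, then his partner in `μ` is
not better than the first woman after his partner in `ν` who would accept him, and the partner of
that woman in `ν` prefers `ν` to `μ` as well. -/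
theorem IsFirstAfter.step [Finite M] (hν : I.IsStable ν) (hμ : I.IsStable μ) {m : M} {w : W}
    (hw : I.IsFirstAfter ν m w) (h : I.rankM m (ν m) < I.rankM m (μ m)) :
    I.rankM m w ≤ I.rankM m (μ m) ∧
      I.rankM (ν.symm w) w < I.rankM (ν.symm w) (μ (ν.symm w)) := by
  have h1 := hν.woman_lt_of_man_lt' hμ h
  have h2 : I.rankM m w ≤ I.rankM m (μ m) := not_lt.1 fun h' => hw.2.2 (μ m) h h' h1
  refine ⟨h2, hν.man_lt_of_woman_lt' hμ ?_⟩
  rcases h2.eq_or_lt with he | hl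
  · rw [I.rankM_injective m he, Equiv.symm_apply_apply]
    exact h1
  · exact (not_lt.1 fun h' => hμ m w ⟨hl, h'⟩).trans_lt hw.2.1

theorem IsExposed.symm_apply (h : I.IsExposed ν ρ) (hp : p ∈ ρ) : ν.symm p.2 = p.1 := by
  rw [Equiv.symm_apply_eq, h.mem_matching p hp]

/-- Every man of `ρ` is worse off in `μ` than in his pair of `ρ`. -/
def Passed (I : SMInstance n M W) (ρ : Cycle (M × W)) (μ : M ≃ W) : Prop :=
  ∀ p ∈ ρ, I.rankM p.1 p.2 < I.rankM p.1 (μ p.1)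

theorem Passed.mono (h : I.Passed ρ μ) (hle : ∀ m, I.rankM m (μ m) ≤ I.rankM m (ν m)) :
    I.Passed ρ ν := fun p hp => (h p hp).trans_le (hle _)

theorem IsExposed.not_passed (h : I.IsExposed ν ρ) : ¬ I.Passed ρ ν := by
  intro hp
  obtain ⟨x, hx⟩ := exists_mem_of_ne_nil h.ne_nil
  have := hp x hx
  rw [h.mem_matching x hx] at this
  exact lt_irrefl _ this

theorem IsExposed.step [Finite M] (h : I.IsExposed ν ρ) (hμ : I.IsStable μ)
    (hpq : Follows ρ p q) (hp : I.rankM p.1 p.2 < I.rankM p.1 (μ p.1)) :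
    I.rankM p.1 q.2 ≤ I.rankM p.1 (μ p.1) ∧ I.rankM q.1 q.2 < I.rankM q.1 (μ q.1) := by
  have h1 := h.mem_matching p hpq.mem_left
  have h2 := h.symm_apply hpq.mem_right
  rw [← h1] at hp
  have := (h.first_after p q hpq).step h.stable hμ hp
  rwa [h2] at this

/-- A stable matching passes all pairs of a rotation or none. -/
theorem IsExposed.passed_of_lt [Finite M] (h : I.IsExposed ν ρ) (hμ : I.IsStable μ)
    (hp : p ∈ ρ) (hlt : I.rankM p.1 p.2 < I.rankM p.1 (μ p.1)) : I.Passed ρ μ :=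
  forall_of_follows h.nodup (fun _ _ hpq hx => (h.step hμ hpq hx).2) hp hlt

theorem IsExposed.le_of_not_passed [Finite M] (h : I.IsExposed ν ρ) (hμ : I.IsStable μ)
    (hn : ¬ I.Passed ρ μ) (hp : p ∈ ρ) : I.rankM p.1 (μ p.1) ≤ I.rankM p.1 p.2 :=
  not_lt.1 fun hlt => hn (h.passed_of_lt hμ hp hlt)

/-- A rotation is determined by any of its pairs. -/
theorem IsExposed.eq_of_mem [Finite M] (hρ : I.IsExposed ν ρ) (hσ : I.IsExposed μ σ)
    (hp : p ∈ ρ) (hp' : p ∈ σ) : ρ = σ := by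
  -- If `σ` skipped `q.2`, she would be better off in `μ` than in `ν`, so `q.1` would be worse off
  -- there and `μ` would pass all of `ρ`; but `p` is still matched in `μ`.
  have women : ∀ {ν μ : M ≃ W} {ρ σ : Cycle (M × W)} {p q q' : M × W}, I.IsExposed ν ρ →
      I.IsExposed μ σ → Follows ρ p q → Follows σ p q' →
      I.rankM p.1 q'.2 ≤ I.rankM p.1 q.2 := by
    intro ν μ ρ σ p q q' hρ hσ h h'
    by_contra! hlt
    have f := hρ.first_after p q h
    have f' := hσ.first_after p q' h'
    have e := hρ.mem_matching p h.mem_left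
    have e' := hσ.mem_matching p h'.mem_left
    have h1 := f'.2.2 q.2 (by rw [e', ← e]; exact f.1) hlt
    have h2 := hρ.stable.man_lt_of_woman_lt' hσ.stable ((not_lt.1 h1).trans_lt f.2.1)
    rw [hρ.symm_apply h.mem_right] at h2
    have h3 := hρ.passed_of_lt hσ.stable h.mem_right h2 p h.mem_left
    rw [e'] at h3
    exact lt_irrefl _ h3
  have not_passed : ∀ {ν μ : M ≃ W} {ρ σ : Cycle (M × W)} {p : M × W}, I.IsExposed ν ρ →
      I.IsExposed μ σ → p ∈ ρ → p ∈ σ → ¬ I.Passed ρ μ := by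
    intro ν μ ρ σ p _ hσ hp hp' h
    have := h p hp
    rw [hσ.mem_matching p hp'] at this
    exact lt_irrefl _ this
  -- As `μ` does not pass `ρ`, the man `q.1` weakly prefers `μ`; opposition of interests then makes
  -- `q.2` weakly prefer `ν`.
  have men : ∀ {ν μ : M ≃ W} {ρ σ : Cycle (M × W)} {p q q' : M × W}, I.IsExposed ν ρ →
      I.IsExposed μ σ → Follows ρ p q → Follows σ p q' → q.2 = q'.2 →
      I.rankW q.2 q.1 ≤ I.rankW q.2 q'.1 := by
    intro ν μ ρ σ p q q' hρ hσ h h' he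
    have h1 := hρ.le_of_not_passed hσ.stable (not_passed hρ hσ h.mem_left h'.mem_left) h.mem_right
    rcases h1.eq_or_lt with h2 | h2
    · have h3 := I.rankM_injective _ h2
      rw [← Equiv.eq_symm_apply, he, hσ.symm_apply h'.mem_right] at h3
      rw [h3]
    · have e := hρ.mem_matching q h.mem_right
      have h2 : I.rankM q.1 (μ q.1) < I.rankM q.1 (ν q.1) := by rwa [e]
      have h3 := hσ.stable.woman_lt_of_man_lt' hρ.stable h2
      rw [e] at h3
      rw [show μ.symm q.2 = q'.1 by rw [he, hσ.symm_apply h'.mem_right]] at h3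
      exact h3.le
  refine cycle_eq_of_follows hρ.nodup hσ.nodup hp hp' fun x y y' h h' => ?_
  have h2 : y.2 = y'.2 :=
    I.rankM_injective x.1 (le_antisymm (women hσ hρ h' h) (women hρ hσ h h'))
  refine Prod.ext (I.rankW_injective y.2 (le_antisymm (men hρ hσ h h' h2) ?_)) h2
  have := men hσ hρ h' h h2.symm
  rwa [← h2] at this

/-- Women improve from `κ` through `ν` to `μ`: a refusal at `κ` persists at `ν`, and an acceptance
at `μ` already held at `ν`. -/
theorem IsExposed.of_squeeze (hν : I.IsStable ν) (hκ : I.IsExposed κ τ) (hμ : I.IsExposed μ τ)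
    (h1 : ∀ m, I.rankM m (κ m) ≤ I.rankM m (ν m)) (h2 : ∀ m, I.rankM m (ν m) ≤ I.rankM m (μ m)) :
    I.IsExposed ν τ := by
  have hmem : ∀ p ∈ τ, ν p.1 = p.2 := by
    intro p hp
    have a := h1 p.1
    have b := h2 p.1
    rw [hκ.mem_matching p hp] at a
    rw [hμ.mem_matching p hp] at b
    exact I.rankM_injective p.1 (le_antisymm b a)
  refine ⟨hν, hκ.ne_nil, hκ.nodup, hmem, fun p q h => ?_⟩
  have e := hmem p h.mem_left
  have fκ := hκ.first_after p q h
  have fμ := hμ.first_after p q h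
  rw [IsFirstAfter, hκ.mem_matching p h.mem_left] at fκ
  rw [IsFirstAfter, hμ.mem_matching p h.mem_left] at fμ
  rw [IsFirstAfter, e]
  refine ⟨fκ.1, fμ.2.1.trans_le (hμ.stable.woman_le h2 _), fun w' a b c => ?_⟩
  exact fκ.2.2 w' a b (c.trans_le (hν.woman_le h1 _))

/-- In the meet each woman keeps one of her two partners, so acceptances and refusals common to `ν`
and `μ` survive. This yields a man-best matching exposing `τ`. -/
theorem IsExposed.exists_meet [Finite M] (hν : I.IsExposed ν τ) (hμ : I.IsExposed μ τ) :
    ∃ κ, I.IsExposed κ τ ∧ (∀ m, I.rankM m (κ m) ≤ I.rankM m (ν m)) ∧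
      (∀ m, I.rankM m (κ m) ≤ I.rankM m (μ m)) := by
  obtain ⟨κ, hκ, hm, hw⟩ := hν.stable.exists_meet hμ.stable
  have hmem : ∀ p ∈ τ, κ p.1 = p.2 := by
    intro p hp
    rcases hm p.1 with ⟨h, -⟩ | ⟨h, -⟩
    · rw [h, hν.mem_matching p hp]
    · rw [h, hμ.mem_matching p hp]
  refine ⟨κ, ⟨hκ, hν.ne_nil, hν.nodup, hmem, fun p q h => ?_⟩, fun m => ?_, fun m => ?_⟩
  · have f := hν.first_after p q h
    have g := hμ.first_after p q h
    rw [IsFirstAfter, hν.mem_matching p h.mem_left] at f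
    rw [IsFirstAfter, hμ.mem_matching p h.mem_left] at g
    rw [IsFirstAfter, hmem p h.mem_left]
    refine ⟨f.1, ?_, fun w' a b => ?_⟩
    · rcases hw q.2 with e | e
      all_goals rw [e]
      exacts [f.2.1, g.2.1]
    · rcases hw w' with e | e
      all_goals rw [e]
      exacts [f.2.2 w' a b, g.2.2 w' a b]
  all_goals
    rcases hm m with ⟨h, h'⟩ | ⟨h, h'⟩
    all_goals have := congrArg (I.rankM m) h; omega

/-- If `μ` passes the rotation `ρ` exposed in `ν`, then `ρ` is exposed in the meet of `ν`
and `μ`. -/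
theorem IsExposed.exists_le_of_passed [Finite M] (hν : I.IsExposed ν ρ) (hμ : I.IsStable μ)
    (hp : I.Passed ρ μ) :
    ∃ κ, I.IsExposed κ ρ ∧ (∀ m, I.rankM m (κ m) ≤ I.rankM m (μ m)) := by
  obtain ⟨κ, hκ, hm, hw⟩ := hν.stable.exists_meet hμ
  have hmem : ∀ p ∈ ρ, κ p.1 = p.2 := by
    intro p h
    have := hp p h
    rw [← hν.mem_matching p h] at this ⊢
    rcases hm p.1 with ⟨h, h'⟩ | ⟨h, h'⟩
    · exact h
    · omega
  refine ⟨κ, ⟨hκ, hν.ne_nil, hν.nodup, hmem, fun p q h => ?_⟩, fun m => ?_⟩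
  · have f := hν.first_after p q h
    have hle := (hν.step hμ h (hp p h.mem_left)).1
    rw [IsFirstAfter, hν.mem_matching p h.mem_left] at f
    rw [IsFirstAfter, hmem p h.mem_left]
    refine ⟨f.1, ?_, fun w' a b => ?_⟩
    · rcases hw q.2 with e | e <;> rw [e]
      · exact f.2.1
      · have hq := hp q h.mem_right
        rw [← hν.mem_matching q h.mem_right] at hq
        have hne : κ q.1 = q.2 := hmem q h.mem_right
        rw [← e, ← hne, Equiv.symm_apply_apply, hne]
        have := f.2.1
        rwa [hν.symm_apply h.mem_right] at this
    · rcases hw w' with e | e <;> rw [e]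
      · exact f.2.2 w' a b
      -- `p.1` prefers `w'` to `q.2`, which he likes at least as much as his `μ`-partner, so a
      -- willing `w'` would block `μ`.
      · exact fun c => hμ p.1 w' ⟨b.trans_le hle, c⟩
  · rcases hm m with ⟨h, h'⟩ | ⟨h, h'⟩ <;> rw [h]
    exact h'

theorem IsElimination.apply_of_follows (he : IsElimination ν ρ ν') (h : Follows ρ p q) :
    ν' p.1 = q.2 := by
  have : (p.1, q.2) ∈ {x : M × W | ν' x.1 = x.2} := by
    rw [he]
    exact .inr ⟨p, q, h, rfl⟩
  exact this

theorem IsElimination.apply_of_notMem (he : IsElimination ν ρ ν') {m : M} (h : (m, ν m) ∉ ρ) :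
    ν' m = ν m := by
  have : (m, ν m) ∈ {x : M × W | ν' x.1 = x.2} := by
    rw [he]
    exact .inl ⟨rfl, h⟩
  exact this

/-- Every exposed rotation can be eliminated, and the result is a stable matching. -/
theorem IsExposed.exists_elimination [Finite M] (h : I.IsExposed ν ρ) :
    ∃ ν', IsElimination ν ρ ν' ∧ I.IsStable ν' := by
  classical
  -- `formPerm` fixes the pairs outside `ρ`, so one formula covers moved and unmoved men, and
  -- injectivity comes from a permutation.
  let g : M → M × W := fun m => ρ.formPerm h.nodup (m, ν m)
  have hg : ∀ m, ν (g m).1 = (g m).2 := by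
    intro m
    by_cases hm : (m, ν m) ∈ ρ
    · exact h.mem_matching _ ((follows_iff_formPerm h.nodup).2 ⟨hm, rfl⟩).mem_right
    · simp [g, Cycle.formPerm_eq_self_of_notMem _ _ _ hm]
  have hinj : Function.Injective fun m => (g m).2 := by
    intro m m' hmm
    have h1 : g m = g m' := by
      refine Prod.ext (ν.injective ?_) hmm
      rw [hg, hg]
      exact hmm
    exact congrArg Prod.fst ((ρ.formPerm h.nodup).injective h1)
  have hbij : Function.Bijective fun m => (g m).2 :=
    ⟨hinj, (Finite.injective_iff_surjective_of_equiv ν).1 hinj⟩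
  let ν' : M ≃ W := Equiv.ofBijective _ hbij
  have he : IsElimination ν ρ ν' := by
    ext ⟨m, w⟩
    change (g m).2 = w ↔ (ν m = w ∧ (m, w) ∉ ρ) ∨ ∃ p q, Follows ρ p q ∧ (m, w) = (p.1, q.2)
    constructor
    · rintro rfl
      by_cases hm : (m, ν m) ∈ ρ
      · exact .inr ⟨(m, ν m), g m, (follows_iff_formPerm h.nodup).2 ⟨hm, rfl⟩, rfl⟩
      · have : g m = (m, ν m) := Cycle.formPerm_eq_self_of_notMem _ _ _ hm
        rw [this]
        exact .inl ⟨rfl, hm⟩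
    · rintro (⟨rfl, hm⟩ | ⟨p, q, hpq, hmw⟩)
      · have : g m = (m, ν m) := Cycle.formPerm_eq_self_of_notMem _ _ _ hm
        rw [this]
      · obtain ⟨rfl, rfl⟩ := Prod.mk.inj hmw
        have e : (p.1, ν p.1) = p := Prod.ext rfl (h.mem_matching p hpq.mem_left)
        have := ((follows_iff_formPerm h.nodup).1 hpq).2
        change (ρ.formPerm h.nodup (p.1, ν p.1)).2 = q.2
        rw [e, this]
  have hw : ∀ w, I.rankW w (ν'.symm w) ≤ I.rankW w (ν.symm w) := by
    intro w
    obtain ⟨m, rfl⟩ := ν'.surjective w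
    rw [Equiv.symm_apply_apply]
    by_cases hm : (m, ν m) ∈ ρ
    · obtain ⟨q, hq⟩ := exists_follows h.nodup hm
      rw [show ν' m = q.2 from he.apply_of_follows hq]
      exact (h.first_after _ _ hq).2.1.le
    · rw [he.apply_of_notMem hm, Equiv.symm_apply_apply]
  refine ⟨ν', he, ?_⟩
  rintro m w ⟨h1, h2⟩
  have h3 := h2.trans_le (hw w)
  have h4 : I.rankM m (ν m) ≤ I.rankM m w := not_lt.1 fun h' => h.stable m w ⟨h', h3⟩
  by_cases hm : (m, ν m) ∈ ρ
  · obtain ⟨q, hq⟩ := exists_follows h.nodup hm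
    rw [show ν' m = q.2 from he.apply_of_follows hq] at h1
    rcases h4.eq_or_lt with h5 | h5
    · have := I.rankM_injective m h5
      rw [← this, Equiv.symm_apply_apply] at h3
      exact lt_irrefl _ h3
    · exact (h.first_after _ _ hq).2.2 w h5 h1 h3
  · rw [he.apply_of_notMem hm] at h1
    omega

/-- Elimination does not overshoot `μ`: a man of `ρ` moves only to the first willing woman, and his
`μ`-partner is no better than she is. -/
theorem IsElimination.le_of_passed [Finite M] (he : IsElimination ν ρ ν') (h : I.IsExposed ν ρ)
    (hμ : I.IsStable μ) (hle : ∀ m, I.rankM m (ν m) ≤ I.rankM m (μ m)) (hp : I.Passed ρ μ)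
    (m : M) : I.rankM m (ν' m) ≤ I.rankM m (μ m) := by
  by_cases hm : (m, ν m) ∈ ρ
  · obtain ⟨q, hq⟩ := exists_follows h.nodup hm
    rw [show ν' m = q.2 from he.apply_of_follows hq]
    exact (h.step hμ hq (hp _ hm)).1
  · rw [he.apply_of_notMem hm]
    exact hle m

theorem IsElimination.sum_lt [Fintype M] (he : IsElimination ν ρ ν') (h : I.IsExposed ν ρ) :
    ∑ m, I.rankM m (ν m) < ∑ m, I.rankM m (ν' m) := by
  obtain ⟨x, hx⟩ := exists_mem_of_ne_nil h.ne_nil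
  refine Finset.sum_lt_sum (fun m _ => he.le h m) ⟨x.1, Finset.mem_univ _, ?_⟩
  rw [h.mem_matching x hx]
  exact he.lt h hx

theorem IsElimination.passed (he : IsElimination ν ρ ν') (h : I.IsExposed ν ρ) :
    I.Passed ρ ν' := fun _ hx => he.lt h hx

/-- If the stable matching `μ` is different from and worse for the men than `ν`, then some rotation
exposed in `ν` is passed by `μ`. -/
theorem IsStable.exists_exposed [Finite M] (hν : I.IsStable ν) (hμ : I.IsStable μ)
    {m₀ : M} (h₀ : I.rankM m₀ (ν m₀) < I.rankM m₀ (μ m₀)) :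
    ∃ ρ, I.IsExposed ν ρ ∧ I.Passed ρ μ := by
  classical
  have : Finite W := Finite.of_equiv M ν
  have first : ∀ m, I.rankM m (ν m) < I.rankM m (μ m) → ∃ w, I.IsFirstAfter ν m w := by
    intro m hm
    let C : Set W := {w | I.rankM m (ν m) < I.rankM m w ∧ I.rankW w m < I.rankW w (ν.symm w)}
    obtain ⟨w, hw, hmin⟩ := Set.exists_min_image C (I.rankM m) C.toFinite
      ⟨μ m, hm, hν.woman_lt_of_man_lt' hμ hm⟩
    exact ⟨w, hw.1, hw.2, fun w' a b c => absurd (hmin w' ⟨a, c⟩) (not_le.2 b)⟩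
  let A := {p : M × W // ν p.1 = p.2 ∧ I.rankM p.1 p.2 < I.rankM p.1 (μ p.1)}
  -- Passing to the current partner of the first willing woman stays among the men who are worse off
  -- in `μ`; a periodic orbit of this map is the rotation.
  have hstep : ∀ p : A, ∃ q : A, I.IsFirstAfter ν p.1.1 q.1.2 := by
    rintro ⟨⟨m, w⟩, rfl : ν m = w, hp⟩
    obtain ⟨w, hw⟩ := first m hp
    exact ⟨⟨(ν.symm w, w), ν.apply_symm_apply w, (hw.step hν hμ hp).2⟩, hw⟩
  choose f hf using hstep
  have : Finite A := Subtype.finite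
  obtain ⟨i, hi⟩ := exists_iterate_mem_periodicPts f ⟨(m₀, ν m₀), rfl, h₀⟩
  set x := f^[i] ⟨(m₀, ν m₀), rfl, h₀⟩
  -- `F` extends `f` by the identity, so that the orbit consists of pairs rather than subtype
  -- elements.
  let F : M × W → M × W := fun p =>
    if h : ν p.1 = p.2 ∧ I.rankM p.1 p.2 < I.rankM p.1 (μ p.1) then (f ⟨p, h⟩).1 else p
  have hsemi : Function.Semiconj (Subtype.val : A → M × W) f F := by
    intro a
    simp only [F]
    rw [dif_pos a.2]
  have hx : x.1 ∈ Function.periodicPts F := by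
    obtain ⟨j, hj, hx⟩ := hi
    exact ⟨j, hj, hx.map hsemi⟩
  have hA : ∀ p ∈ Function.periodicOrbit F x.1, ∃ a : A, a.1 = p := by
    intro p hp
    obtain ⟨j, rfl⟩ := (Function.mem_periodicOrbit_iff hx).1 hp
    exact ⟨f^[j] x, hsemi.iterate_right j x⟩
  refine ⟨Function.periodicOrbit F x.1, ⟨hν, ?_, Function.nodup_periodicOrbit, ?_, ?_⟩, ?_⟩
  · rw [Ne, Function.periodicOrbit_eq_nil_iff_not_periodic_pt, not_not]
    exact hx
  · intro p hp
    obtain ⟨a, rfl⟩ := hA p hp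
    exact a.2.1
  · intro p q hpq
    obtain ⟨a, rfl⟩ := hA p hpq.mem_left
    rw [hpq.eq_apply_of_periodicOrbit, ← hsemi a]
    exact hf a
  · intro p hp
    obtain ⟨a, rfl⟩ := hA p hp
    exact a.2.2

end Rotations

end SMInstance

/-! ### The rotation poset -/

namespace SMInstance

section Poset

variable {n : ℕ} {M W : Type*} {I : SMInstance n M W} {μ ν κ ν' μ₀ : M ≃ W}
  {ρ σ τ : Cycle (M × W)} {S : Set (Cycle (M × W))}

theorem Eliminates.stable (h : I.Eliminates μ S) : I.IsStable μ := by
  cases h with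
  | start μ h => exact h.1
  | step μ μ' S ρ h hρ he hμ' => exact hμ'

theorem Eliminates.exists_isManOptimal (h : I.Eliminates μ S) :
    ∃ μ₀ : M ≃ W, I.IsManOptimal μ₀ := by
  induction h with
  | start μ h => exact ⟨μ, h⟩
  | step μ μ' S ρ h hρ he hμ' ih => exact ih

/-- Eliminations lead from any stable matching to any other one that is worse for the men. -/
theorem Eliminates.extend [Finite M] (h : I.Eliminates ν S) (hμ : I.IsStable μ)
    (hle : ∀ m, I.rankM m (ν m) ≤ I.rankM m (μ m)) :
    ∃ T, S ⊆ T ∧ I.Eliminates μ T := by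
  have := Fintype.ofFinite M
  induction hd : ∑ m, I.rankM m (μ m) - ∑ m, I.rankM m (ν m) using Nat.strong_induction_on
    generalizing ν S with
  | _ d ih =>
    by_cases hlt : ∃ m, I.rankM m (ν m) < I.rankM m (μ m)
    · obtain ⟨m, hm⟩ := hlt
      obtain ⟨ρ, hρ, hp⟩ := h.stable.exists_exposed hμ hm
      obtain ⟨ν', he, hν'⟩ := hρ.exists_elimination
      have hle' := he.le_of_passed hρ hμ hle hp
      have h1 := he.sum_lt hρ
      have h2 : ∑ m, I.rankM m (ν' m) ≤ ∑ m, I.rankM m (μ m) :=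
        Finset.sum_le_sum fun m _ => hle' m
      obtain ⟨T, hT, hμT⟩ := ih _ (by omega) (.step ν ν' S ρ h hρ he hν') hle' rfl
      exact ⟨T, (Set.subset_insert _ _).trans hT, hμT⟩
    · push Not at hlt
      have : ν = μ := by
        ext m
        exact I.rankM_injective m (le_antisymm (hle m) (hlt m))
      subst this
      exact ⟨S, subset_rfl, h⟩

/-- Go from the man-optimal matching down to one above `μ` that exposes `ρ`, eliminate `ρ`, and
continue down to `μ`. -/
theorem mem_eliminatedSet_of_passed [Finite M] (h₀ : I.IsManOptimal μ₀) (hρ : I.IsExposed ν ρ)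
    (hμ : I.IsStable μ) (hp : I.Passed ρ μ) : ρ ∈ I.eliminatedSet μ := by
  obtain ⟨κ, hκ, hle⟩ := hρ.exists_le_of_passed hμ hp
  obtain ⟨S, -, hS⟩ := (Eliminates.start μ₀ h₀).extend hκ.stable (h₀.2 κ hκ.stable)
  obtain ⟨κ', he, hκ'⟩ := hκ.exists_elimination
  obtain ⟨T, hT, hμT⟩ := (Eliminates.step κ κ' S ρ hS hκ he hκ').extend hμ
    (he.le_of_passed hκ hμ hle hp)
  exact ⟨T, hμT, hT (Set.mem_insert _ _)⟩

theorem passed_of_mem_eliminatedSet (h : ρ ∈ I.eliminatedSet μ) : I.Passed ρ μ := by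
  obtain ⟨S, hS, hρ⟩ := h
  exact fun x hx => hS.lt hρ hx

theorem precedes_iff [Finite M] (h₀ : I.IsManOptimal μ₀) (ρ σ : I.Rotation) :
    I.Precedes ρ σ ↔ ∀ μ, I.IsExposed μ σ.1 → I.Passed ρ.1 μ := by
  refine forall₂_congr fun μ hμ => ⟨passed_of_mem_eliminatedSet, fun h => ?_⟩
  obtain ⟨ν, hν⟩ := ρ.2
  exact mem_eliminatedSet_of_passed h₀ hν hμ.stable h

/-- If eliminating `ρ` makes `τ` exposed, then `ρ` is passed whenever `τ` is exposed. -/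
theorem IsElimination.passed_of_isExposed [Finite M] (he : IsElimination ν ρ ν')
    (hρ : I.IsExposed ν ρ) (hτ : I.IsExposed ν' τ) (hn : ¬ I.IsExposed ν τ)
    (hμ : I.IsExposed μ τ) : I.Passed ρ μ := by
  -- If `μ` does not pass `ρ`, neither does the meet `κ` of `ν'` and `μ`. Then `κ` is at least as
  -- good for the men as `ν`, so `ν` is squeezed between `κ` and `ν'` and exposes `τ`.
  obtain ⟨κ, hκ, h1, h2⟩ := hτ.exists_meet hμ
  by_contra hp
  have hp' : ¬ I.Passed ρ κ := fun h => hp (h.mono h2)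
  refine hn (hκ.of_squeeze hρ.stable hτ (fun m => ?_) (he.le hρ))
  by_cases hm : (m, ν m) ∈ ρ
  · exact hρ.le_of_not_passed hκ.stable hp' hm
  · rw [← he.apply_of_notMem hm]
    exact h1 m

/-- The pairs of `ρ` stay in place, and since women only improve, those who refused continue to
refuse. -/
theorem IsElimination.isExposed_of_isExposed (he : IsElimination ν τ κ) (hκ : I.IsStable κ)
    (hρ : I.IsExposed ν ρ) (hτ : I.IsExposed ν τ)
    (hd : ∀ p ∈ ρ, p ∉ τ) : I.IsExposed κ ρ := by
  have hmem : ∀ p ∈ ρ, κ p.1 = p.2 := by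
    intro p hp
    have := hρ.mem_matching p hp
    rw [he.apply_of_notMem (by rw [this]; exact hd p hp), this]
  refine ⟨hκ, hρ.ne_nil, hρ.nodup, hmem, fun p q h => ?_⟩
  have f := hρ.first_after p q h
  rw [IsFirstAfter, hρ.mem_matching p h.mem_left, hρ.symm_apply h.mem_right] at f
  have e : κ.symm q.2 = q.1 := by rw [Equiv.symm_apply_eq, hmem q h.mem_right]
  rw [IsFirstAfter, hmem p h.mem_left, e]
  exact ⟨f.1, f.2.1, fun w' a b c =>
    f.2.2 w' a b (c.trans_le (hκ.woman_le (he.le hτ) w'))⟩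

/-- If `σ` covers `ρ` in the rotation poset, then some elimination of `ρ` makes `σ` exposed. -/
theorem exists_isElimination_of_covBy [Finite M] {ρ σ : I.Rotation} (h : ρ ⋖ σ) :
    ∃ ν ν' : M ≃ W, I.IsExposed ν ρ.1 ∧ IsElimination ν ρ.1 ν' ∧ I.IsExposed ν' σ.1 ∧
      ¬ I.IsExposed ν σ.1 := by
  have := Fintype.ofFinite M
  have : Finite (M ≃ W) := by
    obtain ⟨μ, -⟩ := σ.2
    have : Finite W := Finite.of_equiv M μ
    infer_instance
  have hlt : I.Precedes ρ σ := h.1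
  -- A man-optimal matching is read off from the elimination sequence witnessing `ρ ≺ σ`.
  obtain ⟨μ₀, h₀⟩ : ∃ μ₀ : M ≃ W, I.IsManOptimal μ₀ := by
    obtain ⟨μ, hμ⟩ := σ.2
    obtain ⟨S, hS, -⟩ := hlt μ hμ
    exact hS.exists_isManOptimal
  rw [precedes_iff h₀] at hlt
  let weight : (M ≃ W) → ℕ := fun μ => ∑ m, I.rankM m (μ m)
  obtain ⟨μ, hμ, hmin⟩ := Set.exists_min_image {μ | I.IsExposed μ σ.1} weight (Set.toFinite _) σ.2
  have hleast : ∀ μ', I.IsExposed μ' σ.1 → ∀ m, I.rankM m (μ m) ≤ I.rankM m (μ' m) := by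
    intro μ' hμ'
    obtain ⟨κ, hκ, h1, h2⟩ := IsExposed.exists_meet (show I.IsExposed μ σ.1 from hμ) hμ'
    rw [← matching_eq_of_sum_le h1 (hmin κ hκ)]
    exact h2
  obtain ⟨ν₀, hν₀⟩ := ρ.2
  -- Delay `ρ` as long as possible on the way to `μ`, the man-best matching exposing `σ`. If `σ` is
  -- still not exposed after `ρ`, the next rotation `τ` towards `μ` will lie strictly between them.
  obtain ⟨ν, ⟨hν, hle⟩, hmax⟩ := Set.exists_max_image
    {ν | I.IsExposed ν ρ.1 ∧ ∀ m, I.rankM m (ν m) ≤ I.rankM m (μ m)} weight (Set.toFinite _)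
    (hν₀.exists_le_of_passed hμ.stable (hlt μ hμ))
  obtain ⟨ν', he, hν'⟩ := hν.exists_elimination
  have hle' := he.le_of_passed hν hμ.stable hle (hlt μ hμ)
  refine ⟨ν, ν', hν, he, ?_, fun hσ => hν.not_passed (hlt ν hσ)⟩
  by_contra hnot
  obtain ⟨m, hm⟩ : ∃ m, I.rankM m (ν' m) < I.rankM m (μ m) := by
    by_contra! hge
    have : ν' = μ := by
      ext m
      exact I.rankM_injective m (le_antisymm (hle' m) (hge m))
    exact hnot (this ▸ hμ)
  obtain ⟨τ, hτ, hpτ⟩ := hν'.exists_exposed hμ.stable hm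
  -- Otherwise `τ` could be eliminated before `ρ`, contradicting the maximality of `ν`.
  have hτν : ¬ I.IsExposed ν τ := by
    intro hτν
    obtain ⟨κ, heκ, hκ⟩ := hτν.exists_elimination
    have hκρ := heκ.isExposed_of_isExposed hκ hν hτν fun p hp hp' => by
      have := he.passed hν p hp
      rw [hτ.mem_matching p hp'] at this
      exact lt_irrefl _ this
    have hs := heκ.sum_lt hτν
    exact absurd (hmax κ ⟨hκρ, heκ.le_of_passed hτν hμ.stable hle hpτ⟩) (not_le.2 hs)
  let τ' : I.Rotation := ⟨τ, ν', hτ⟩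
  have h1 : I.Precedes ρ τ' :=
    (precedes_iff h₀ _ _).2 fun κ hκ => he.passed_of_isExposed hν hτ hτν hκ
  have h2 : I.Precedes τ' σ := (precedes_iff h₀ _ _).2 fun κ hκ => hpτ.mono (hleast κ hκ)
  exact h.2 h1 h2

/-- If `σ` covers `ρ` in the rotation poset, then `ρ` and `σ` have a common man, or `ρ` moves some
woman above a man whom `σ` moves below her. -/
theorem exists_moves_of_covBy [Finite M] {ρ σ : I.Rotation} (h : ρ ⋖ σ) :
    (∃ p ∈ ρ.1, ∃ q ∈ σ.1, p.1 = q.1) ∨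
      ∃ m w, I.MovesWomanAbove ρ.1 w m ∧ I.MovesManBelow σ.1 m w := by
  obtain ⟨ν, ν', hρ, he, hσ, hn⟩ := exists_isElimination_of_covBy h
  by_cases hdis : ∃ p ∈ ρ.1, ∃ q ∈ σ.1, p.1 = q.1
  · exact .inl hdis
  push Not at hdis
  refine .inr ?_
  have hne : ∀ p ∈ σ.1, (p.1, ν p.1) ∉ ρ.1 := fun p hp h => hdis _ h p hp rfl
  have hmem : ∀ p ∈ σ.1, ν p.1 = p.2 := by
    intro p hp
    rw [← he.apply_of_notMem (hne p hp)]
    exact hσ.mem_matching p hp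
  by_contra hno
  push Not at hno
  refine hn ⟨hρ.stable, hσ.ne_nil, hσ.nodup, hmem, fun p q hpq => ?_⟩
  have f := hσ.first_after p q hpq
  have hw := hσ.stable.woman_le (he.le hρ)
  rw [IsFirstAfter, hσ.mem_matching p hpq.mem_left] at f
  rw [IsFirstAfter, hmem p hpq.mem_left]
  refine ⟨f.1, f.2.1.trans_le (hw _), fun w' a b c => ?_⟩
  refine hno p.1 w' ?_ ⟨p, q, hpq, rfl, a, b⟩
  have d := f.2.2 w' a b
  by_cases hm : (ν'.symm w', ν (ν'.symm w')) ∈ ρ.1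
  · obtain ⟨s, hs⟩ := exists_follows hρ.nodup hm
    have e : s.2 = w' := by
      rw [← he.apply_of_follows hs]
      exact ν'.apply_symm_apply w'
    have e' : ν.symm w' = s.1 := by rw [← e, hρ.symm_apply hs.mem_right]
    refine ⟨_, s, hs, e, lt_of_le_of_ne (not_lt.1 d) fun h' => ?_, by rwa [e'] at c⟩
    exact hdis _ hm p hpq.mem_left (I.rankW_injective _ h')
  · have e := he.apply_of_notMem hm
    rw [Equiv.apply_symm_apply, ← Equiv.symm_apply_eq] at e
    rw [e] at c
    exact absurd c d

end Poset

end SMInstance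

/-! ### Ranks in instances of bounded range -/

namespace SMInstance

section Range

variable {n k : ℕ} {M W : Type*} {I : SMInstance n M W} {μ ν ν' : M ≃ W}

theorem rankW_le (I : SMInstance n M W) (w : W) (m : M) : I.rankW w m ≤ n := (I.womenList w m).2

/-- The instance with the roles of men and women exchanged. -/
def swap (I : SMInstance n M W) : SMInstance n W M where
  card_men := I.card_women
  card_women := I.card_men
  menList := I.womenList
  womenList := I.menList

theorem IsStable.swap (h : I.IsStable μ) : I.swap.IsStable μ.symm :=
  fun w m h' => h m w ⟨h'.2, h'.1⟩

theorem range_swap (I : SMInstance n M W) : I.swap.range = I.range := by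
  unfold range
  rw [max_comm]
  rfl

theorem minrankMan_le (I : SMInstance n M W) (m : M) (w : W) : I.minrankMan m ≤ I.rankW w m :=
  ciInf_le (OrderBot.bddBelow _) w

theorem le_maxrankMan (I : SMInstance n M W) (m : M) (w : W) : I.rankW w m ≤ I.maxrankMan m :=
  le_ciSup (f := fun w => I.rankW w m) ⟨n, by rintro _ ⟨w, rfl⟩; exact I.rankW_le w m⟩ w

theorem minrankWoman_le (I : SMInstance n M W) (w : W) (m : M) :
    I.minrankWoman w ≤ I.rankM m w :=
  I.swap.minrankMan_le w m

theorem maxrankMan_lt (hn : 0 < n) (hI : I.range ≤ k) (m : M) :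
    I.maxrankMan m < I.minrankMan m + k := by
  -- Needed for boundedness: an unbounded supremum in `ℕ` would be `0`.
  have := I.finite_men hn
  have h1 : I.maxrankMan m - I.minrankMan m ≤ ⨆ m : M, (I.maxrankMan m - I.minrankMan m) :=
    le_ciSup (f := fun m => I.maxrankMan m - I.minrankMan m) (Set.finite_range _).bddAbove m
  have h2 := h1.trans (le_max_left _ (⨆ w : W, (I.maxrankWoman w - I.minrankWoman w)))
  unfold range at hI
  omega

theorem rankW_lt (hn : 0 < n) (hI : I.range ≤ k) (m : M) (w : W) :
    I.rankW w m < I.minrankMan m + k :=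
  (I.le_maxrankMan m w).trans_lt (maxrankMan_lt hn hI m)

theorem rankM_lt (hn : 0 < n) (hI : I.range ≤ k) (m : M) (w : W) :
    I.rankM m w < I.minrankWoman w + k :=
  rankW_lt (I := I.swap) hn (by rwa [range_swap]) w m

/-- In a stable matching, no man gets a woman much worse than his own position. -/
theorem IsStable.rankM_le_minrankMan (hn : 0 < n) (hI : I.range ≤ k) (hμ : I.IsStable μ) (m : M) :
    I.rankM m (μ m) ≤ I.minrankMan m + 2 * k := by
  have hk : 1 ≤ k := le_trans (Nat.le_add_left _ _) hI
  -- Each woman `w` whom `m` prefers to `μ m` has a partner she ranks no lower than `m`, so below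
  -- `minrankMan m + k`. The woman `μ m` then ranks that partner below `minrankMan m + 2 * k`;
  -- counting positions on her list bounds the number of such `w`.
  let f : Fin n → ℕ := fun i => I.womenList (μ m) (μ.symm ((I.menList m).symm i))
  have hf : Function.Injective f := by
    intro i j hij
    have h1 := (I.womenList (μ m)).injective (Fin.ext hij)
    exact (I.menList m).symm.injective (μ.symm.injective h1)
  have hmaps : Set.MapsTo f (Finset.Iio (I.menList m (μ m)))
      (Finset.range (I.minrankMan m + 2 * k - 1)) := by
    intro i hi
    have hi' : i < I.menList m (μ m) := by simpa using hi
    set w := (I.menList m).symm i with hw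
    have h1 : I.rankM m w < I.rankM m (μ m) := by
      have : (I.menList m w : ℕ) < I.menList m (μ m) := by
        rw [hw, Equiv.apply_symm_apply]
        exact hi'
      unfold rankM
      omega
    have h2 : I.rankW w (μ.symm w) ≤ I.rankW w m := not_lt.1 fun h => hμ m w ⟨h1, h⟩
    have h3 := rankW_lt hn hI m w
    have h4 := I.minrankMan_le (μ.symm w) w
    have h5 := rankW_lt hn hI (μ.symm w) (μ m)
    have h6 : f i + 1 = I.rankW (μ m) (μ.symm w) := rfl
    rw [Finset.coe_range, Set.mem_Iio]
    omega
  have hcard := Finset.card_le_card_of_injOn f hmaps hf.injOn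
  rw [Fin.card_Iio, Finset.card_range] at hcard
  unfold rankM
  omega

theorem IsStable.rankW_le_minrankWoman (hn : 0 < n) (hI : I.range ≤ k) (hμ : I.IsStable μ)
    (w : W) : I.rankW w (μ.symm w) ≤ I.minrankWoman w + 2 * k :=
  hμ.swap.rankM_le_minrankMan hn (by rwa [range_swap]) w

/-! ### The path decomposition -/

/-- The rotations whose men's ranks extend on both sides of `t`. -/
def rotationBag (I : SMInstance n M W) (t : ℕ) : Set I.Rotation :=
  {ρ | (∃ p ∈ ρ.1, I.minrankMan p.1 ≤ t) ∧ ∃ p ∈ ρ.1, t ≤ I.maxrankMan p.1}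

theorem mem_rotationBag_of_mem {ρ : I.Rotation} {p : M × W} (hp : p ∈ ρ.1) (w : W) :
    ρ ∈ I.rotationBag (I.rankW w p.1) :=
  ⟨⟨p, hp, I.minrankMan_le _ _⟩, ⟨p, hp, I.le_maxrankMan _ _⟩⟩

theorem exists_rotationBag_of_common {ρ σ : I.Rotation} {p q : M × W} (hp : p ∈ ρ.1)
    (hq : q ∈ σ.1) (h : p.1 = q.1) : ∃ t ≤ n, ρ ∈ I.rotationBag t ∧ σ ∈ I.rotationBag t :=
  ⟨_, I.rankW_le p.2 p.1, mem_rotationBag_of_mem hp _, h ▸ mem_rotationBag_of_mem hq _⟩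

theorem exists_rotationBag_of_moves {ρ σ : I.Rotation} {m : M} {w : W}
    (hρ : I.MovesWomanAbove ρ.1 w m) (hσ : I.MovesManBelow σ.1 m w) :
    ∃ t ≤ n, ρ ∈ I.rotationBag t ∧ σ ∈ I.rotationBag t := by
  obtain ⟨p, q, hpq, -, h1, h2⟩ := hρ
  obtain ⟨r, _, hr, rfl, -⟩ := hσ
  refine ⟨_, I.rankW_le w r.1, ⟨⟨p, hpq.mem_left, ?_⟩, ⟨q, hpq.mem_right, ?_⟩⟩,
    mem_rotationBag_of_mem hr.mem_left w⟩
  · exact (I.minrankMan_le p.1 w).trans h1.le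
  · exact h2.le.trans (I.le_maxrankMan q.1 w)

/-- A rotation in the bag of `t` has a pair whose woman has a position close to `t`. -/
theorem exists_mem_of_mem_rotationBag (hn : 0 < n) (hI : I.range ≤ k) {ρ : I.Rotation} {t : ℕ}
    (h : ρ ∈ I.rotationBag t) : ∃ p ∈ ρ.1,
      t < I.minrankWoman p.2 + 3 * k ∧ I.minrankWoman p.2 ≤ t + 2 * k ∧
      I.rankW p.2 p.1 ≤ I.minrankWoman p.2 + 2 * k ∧
      I.minrankWoman p.2 ≤ I.rankW p.2 p.1 + 2 * k := by
  have := I.finite_men hn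
  obtain ⟨ν, hν⟩ := ρ.2
  have hk : 1 ≤ k := le_trans (Nat.le_add_left _ _) hI
  have hwoman : ∀ p ∈ ρ.1, I.rankW p.2 p.1 ≤ I.minrankWoman p.2 + 2 * k := by
    intro p hp
    rw [← hν.symm_apply hp]
    exact hν.stable.rankW_le_minrankWoman hn hI p.2
  have hman : ∀ p ∈ ρ.1, I.minrankWoman p.2 ≤ I.minrankMan p.1 + 2 * k := by
    intro p hp
    have h1 := hν.stable.rankM_le_minrankMan hn hI p.1
    rw [hν.mem_matching p hp] at h1
    exact (I.minrankWoman_le p.2 p.1).trans h1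
  by_cases hcase : ∃ p ∈ ρ.1, I.minrankMan p.1 ≤ t ∧ t ≤ I.maxrankMan p.1
  · obtain ⟨p, hp, h1, h2⟩ := hcase
    have h3 := maxrankMan_lt hn hI p.1
    have h4 := I.minrankMan_le p.1 p.2
    have h5 := hwoman p hp
    have h6 := hman p hp
    exact ⟨p, hp, by omega, by omega, h5, by omega⟩
  · push Not at hcase
    obtain ⟨⟨p, hp, hpt⟩, q, hq, hqt⟩ := h
    -- No man of `ρ` straddles `t`, so around the cycle some consecutive men jump over it. The woman
    -- `y.2` is matched to `y.1` before the elimination and to `x.1` after it, which bounds her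
    -- position from both sides.
    obtain ⟨x, y, hxy, hx, hy⟩ : ∃ x y, Follows ρ.1 x y ∧ I.minrankMan x.1 ≤ t ∧
        t < I.minrankMan y.1 := by
      by_contra! hno
      have := forall_of_follows hν.nodup (P := fun x => I.minrankMan x.1 ≤ t)
        (fun x y hxy hx => hno x y hxy hx) hp hpt q hq
      exact absurd (hcase q hq this) (not_lt.2 hqt)
    obtain ⟨ν', he, hν'⟩ := hν.exists_elimination
    have h1 := hν'.rankM_le_minrankMan hn hI x.1
    rw [he.apply_of_follows hxy] at h1
    have h2 := I.minrankWoman_le y.2 x.1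
    have h3 := I.minrankMan_le y.1 y.2
    have h4 := hwoman y hxy.mem_right
    have h5 := hman y hxy.mem_right
    exact ⟨y, hxy.mem_right, by omega, by omega, h4, by omega⟩

theorem encard_rotationBag_le (hn : 0 < n) (hI : I.range ≤ k) (t : ℕ) :
    (I.rotationBag t).encard ≤ 50 * (k : ℕ∞) ^ 2 := by
  have := I.finite_men hn
  have hk : 1 ≤ k := le_trans (Nat.le_add_left _ _) hI
  obtain ⟨m₀⟩ : Nonempty M := (Nat.card_pos_iff.1 (by rw [I.card_men]; exact hn)).1
  have hex : ∀ ρ : I.Rotation, ∃ p : M × W, ρ ∈ I.rotationBag t → p ∈ ρ.1 ∧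
      t < I.minrankWoman p.2 + 3 * k ∧ I.minrankWoman p.2 ≤ t + 2 * k ∧
      I.rankW p.2 p.1 ≤ I.minrankWoman p.2 + 2 * k ∧
      I.minrankWoman p.2 ≤ I.rankW p.2 p.1 + 2 * k := by
    intro ρ
    obtain ⟨ν, hν⟩ := ρ.2
    obtain ⟨x, -⟩ := exists_mem_of_ne_nil hν.ne_nil
    by_cases h : ρ ∈ I.rotationBag t
    · obtain ⟨p, hp⟩ := exists_mem_of_mem_rotationBag hn hI h
      exact ⟨p, fun _ => hp⟩
    · exact ⟨x, fun h' => absurd h' h⟩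
  choose g hg using hex
  -- A fixed man `m₀` ranks each woman within `k` of her `minrankWoman`, so his rank identifies her
  -- among `6 * k` values. The shifts by `3 * k` and `2 * k` keep the subtractions from truncating.
  let f : I.Rotation → ℕ × ℕ := fun ρ =>
    (I.rankM m₀ (g ρ).2 + 3 * k - t,
      I.rankW (g ρ).2 (g ρ).1 + 2 * k - I.minrankWoman (g ρ).2)
  have hmaps : Set.MapsTo f (I.rotationBag t)
      (Finset.range (6 * k) ×ˢ Finset.range (4 * k + 1) : Finset (ℕ × ℕ)) := by
    intro ρ hρ
    obtain ⟨-, h1, h2, h3, h4⟩ := hg ρ hρ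
    have h5 := rankM_lt hn hI m₀ (g ρ).2
    have h6 := I.minrankWoman_le (g ρ).2 m₀
    simp only [f, Finset.coe_product, Set.mem_prod, Finset.mem_coe, Finset.mem_range]
    omega
  have hinj : Set.InjOn f (I.rotationBag t) := by
    intro ρ hρ σ hσ h
    obtain ⟨hρ', a1, a2, a3, a4⟩ := hg ρ hρ
    obtain ⟨hσ', b1, b2, b3, b4⟩ := hg σ hσ
    obtain ⟨h1, h2⟩ := Prod.mk.inj h
    have a5 := I.minrankWoman_le (g ρ).2 m₀
    have b5 := I.minrankWoman_le (g σ).2 m₀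
    have hw : (g ρ).2 = (g σ).2 := I.rankM_injective m₀ (by omega)
    rw [hw] at h2 a4
    have hm : (g ρ).1 = (g σ).1 := I.rankW_injective (g σ).2 (by omega)
    have hp : g ρ = g σ := Prod.ext hm hw
    obtain ⟨ν, hν⟩ := ρ.2
    obtain ⟨μ, hμ⟩ := σ.2
    exact Subtype.ext (hν.eq_of_mem hμ hρ' (hp ▸ hσ'))
  refine (Set.encard_le_encard_of_injOn hmaps hinj).trans ?_
  rw [Set.encard_coe_eq_coe_finsetCard, Finset.card_product, Finset.card_range, Finset.card_range]
  -- The left side is at most `30 * k ^ 2`, so the constant has slack.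
  have : 6 * k * (4 * k + 1) ≤ 50 * k ^ 2 := by nlinarith
  exact_mod_cast this

/-- If any two adjacent rotations share a bag, then the bags form a path decomposition. -/
theorem pathwidth_le_of_exists_rotationBag (hn : 0 < n) (hI : I.range ≤ k)
    (G : SimpleGraph I.Rotation)
    (hG : ∀ ρ σ, G.Adj ρ σ → ∃ t ≤ n, ρ ∈ I.rotationBag t ∧ σ ∈ I.rotationBag t) :
    pathwidth G ≤ 50 * (k : ℕ∞) ^ 2 := by
  let X : PathDecomposition G :=
    { length := n + 1
      bag := fun t => I.rotationBag t
      cover := by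
        refine Set.eq_univ_of_forall fun ρ => ?_
        obtain ⟨ν, hν⟩ := ρ.2
        obtain ⟨x, hx⟩ := exists_mem_of_ne_nil hν.ne_nil
        exact Set.mem_iUnion.2 ⟨⟨_, Nat.lt_succ_of_le (I.rankW_le x.2 x.1)⟩,
          mem_rotationBag_of_mem hx x.2⟩
      edge := by
        intro ρ σ h
        obtain ⟨t, ht, h⟩ := hG ρ σ h
        exact ⟨⟨t, Nat.lt_succ_of_le ht⟩, h⟩
      interval := by
        rintro i j l hij hjl ρ ⟨⟨⟨p, hp, hpi⟩, -⟩, -, q, hq, hql⟩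
        exact ⟨⟨p, hp, hpi.trans hij⟩, q, hq, le_trans hjl hql⟩ }
  -- The minus one in the width is discarded.
  refine (iInf_le _ X).trans (tsub_le_self.trans (iSup_le fun t => ?_))
  exact encard_rotationBag_le hn hI t

end Range

end SMInstance

theorem mainTheorem7 {M W : Type*} (n k : ℕ) (hn : 0 < n) (I : SMInstance n M W)
    (hI : I.range ≤ k) :
    pathwidth (SimpleGraph.hasse I.Rotation) ≤ 50 * (k : ℕ∞) ^ 2 ∧
    pathwidth I.rotationDigraph.toSimpleGraphInclusive ≤ 50 * (k : ℕ∞) ^ 2 := by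
  have := I.finite_men hn
  constructor
  · have key : ∀ ρ σ : I.Rotation, ρ ⋖ σ →
        ∃ t ≤ n, ρ ∈ I.rotationBag t ∧ σ ∈ I.rotationBag t := by
      intro ρ σ h
      rcases SMInstance.exists_moves_of_covBy h with ⟨p, hp, q, hq, e⟩ | ⟨m, w, h1, h2⟩
      · exact SMInstance.exists_rotationBag_of_common hp hq e
      · exact SMInstance.exists_rotationBag_of_moves h1 h2
    refine SMInstance.pathwidth_le_of_exists_rotationBag hn hI _ fun ρ σ h => ?_
    rcases h with h | h
    · exact key ρ σ h
    · obtain ⟨t, ht, h1, h2⟩ := key σ ρ h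
      exact ⟨t, ht, h2, h1⟩
  · have key : ∀ ρ σ : I.Rotation, I.rotationDigraph.Adj ρ σ →
        ∃ t ≤ n, ρ ∈ I.rotationBag t ∧ σ ∈ I.rotationBag t := by
      rintro ρ σ (⟨m, w, hσ, p, q, hpq, e, -⟩ | ⟨m, w, -, h1, h2, -⟩)
      · exact SMInstance.exists_rotationBag_of_common hpq.mem_left hσ e
      · exact SMInstance.exists_rotationBag_of_moves h1 h2
    refine SMInstance.pathwidth_le_of_exists_rotationBag hn hI _ fun ρ σ h => ?_
    rcases h with ⟨-, h | h⟩
    · exact key ρ σ h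
    · obtain ⟨t, ht, h1, h2⟩ := key σ ρ h
      exact ⟨t, ht, h2, h1⟩
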